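/- Let $\Bbbk$ be a field, let $n,c,s$ be integers with $1\le c\le n$ and $s\ge n+1$, and let $\mathcal F=\{F_1,\dots,F_s\}$ be a set of forms in $R=\Bbbk[x_0,\dots,x_n]$ such that every subset of $\mathcal F$ of cardinality $c+1$ is a regular sequence in $R$. Put $$I_{c,\mathcal F}=\bigcap_{1\le i_1<\dots<i_c\le s}\langle F_{i_1},\dots,F_{i_c}\rangle ,$$ the defining ideal of a star configuration. For an ideal $I\subseteq R$ and $m\ge 1$ let $I^{(m)}=\bigcap_{P\in\operatorname{Ass}(I)}(I^mR_P\cap R)$ be the $m$-th symbolic power, where $\operatorname{Ass}(I)$ is the set of associated primes of $R/I$, and let $\operatorname{sdefect}(I,m)$ be the minimal number of generators of the $R$-module $I^{(m)}/I^m$. Then $$\operatorname{sdefect}(I_{c,\mathcal F},2)\le\binom{s}{c-2}.$$ If moreover all the forms $F_1,\dots,F_s$ are linear (a linear star configuration, written $\mathcal F=\mathcal L$), then $$\operatorname{sdefect}(I_{c,\mathcal L},2)=\binom{s}{c-2}.$$ Here $\binom{s}{c-2}=0$ when $c=1$. -/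

import Mathlib

namespace StarConfig

/-- The `m`-th symbolic power `I^(m) = ⋂_{P ∈ Ass(I)} (I^m R_P ∩ R)`, where `Ass(I)` is the set of
associated primes of `R/I`. -/
noncomputable def symbolicPower {R : Type*} [CommRing R] (I : Ideal R) (m : ℕ) : Ideal R :=
  ⨅ P : associatedPrimes R (R ⧸ I),
    ((I ^ m).map (algebraMap R (Localization.AtPrime P.1))).comap
      (algebraMap R (Localization.AtPrime P.1))

theorem pow_le_symbolicPower {R : Type*} [CommRing R] (I : Ideal R) (m : ℕ) :
    I ^ m ≤ symbolicPower I m :=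
  le_iInf fun _ => Ideal.le_comap_map

/-- The `R`-module `I^(m) / I^m`, as a submodule of `R / I^m`. -/
noncomputable def symbolicQuotient {R : Type*} [CommRing R] (I : Ideal R) (m : ℕ) :
    Submodule R (R ⧸ I ^ m) :=
  Submodule.map (Submodule.mkQ (I ^ m)) (symbolicPower I m)

theorem symbolicQuotient_fg {R : Type*} [CommRing R] [IsNoetherianRing R] (I : Ideal R) (m : ℕ) :
    (symbolicQuotient I m).FG :=
  (IsNoetherian.noetherian (symbolicPower I m)).map _

/-- The `m`-th symbolic defect of `I`: the minimal number of generators of the `R`-module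
`I^(m) / I^m` (which is finitely generated when `R` is Noetherian). -/
noncomputable def sdefect {R : Type*} [CommRing R] (I : Ideal R) (m : ℕ) : ℕ :=
  (symbolicQuotient I m).spanFinrank

/-- `F₁, …, F_s` are forms in `k[x₀, …, x_n]` that define a star configuration of codimension `c`
in `ℙⁿ`: we have `1 ≤ c ≤ n < s`, and any `c + 1` of the forms, at distinct indices, are a regular
sequence. (For forms the order of a regular sequence is immaterial, so all orders are allowed.) -/
structure IsStarFamily {k : Type*} [Field k] {n s : ℕ} (c : ℕ)
    (F : Fin s → MvPolynomial (Fin (n + 1)) k) : Prop where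
  one_le : 1 ≤ c
  le_dim : c ≤ n
  lt_card : n + 1 ≤ s
  form : ∀ i, ∃ d, (F i).IsHomogeneous d
  regular : ∀ e : Fin (c + 1) ↪ Fin s,
    RingTheory.Sequence.IsRegular (MvPolynomial (Fin (n + 1)) k) (List.ofFn fun j => F (e j))

/-- The ideal `I_{c,F} = ⋂_{i₁ < ⋯ < i_c} ⟨F_{i₁}, …, F_{i_c}⟩`. -/
noncomputable def starIdeal {R : Type*} [CommRing R] {s : ℕ} (c : ℕ) (F : Fin s → R) : Ideal R :=
  ⨅ t ∈ Finset.powersetCard c (Finset.univ : Finset (Fin s)), Ideal.span (F '' (t : Set (Fin s)))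

/-- The binomial coefficient `binom(a, b)` for `b ∈ ℤ`, equal to `0` for `b < 0`. -/
def binom (a : ℕ) (b : ℤ) : ℕ := if b < 0 then 0 else a.choose b.toNat

end StarConfig

/-! Write `J_t` for the ideal generated by the `F i`, `i ∈ t`. The star ideal `I = ⋂ J_t`, over `#t
= c`, is generated by the products of `s - c + 1` forms at distinct indices. The heart of the proof
is the analogue for squares: `⋂ J_t ^ 2 = A + I ^ 2`, with `A` generated by the products of `s - c +
2` such forms (`RegularUpTo.mem_prodIdeal_sup_sq`). Both are proved by splitting off one form `F g`,
relative to an auxiliary ideal `K`: the `t` containing `g` are treated modulo `F g` with `c` lowered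
by one, and for the `t` avoiding `g` the factor `F g` cancels.

The intersection of squares is `I^(2)`: `Ass(R/I)` is the union of the `Ass(R/J_t)`, and a
nonzerodivisor modulo `J_t` stays one modulo `J_t ^ 2`. So `I^(2)/I^2` is generated by `binom(s,
s-c+2) = binom(s, c-2)` products.

For linear forms these products are linearly independent of degree `s - c + 2`, while `I ^ 2` starts
in degree at least `2(s - c + 1) > s - c + 2`; comparing components of lowest degree, no fewer
generators suffice. -/

open Finset in
theorem Ideal.exists_sum_of_mem_mul_span_image {R ι : Type*} [CommRing R] (J : Ideal R)
    (F : ι → R) (t : Finset ι) {x : R} (hx : x ∈ J * Ideal.span (F '' t)) :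
    ∃ g : ι → R, (∀ i, g i ∈ J) ∧ ∑ i ∈ t, g i * F i = x := by
  induction hx using Submodule.mul_induction_on' with
  | mem_mul_mem m hm n hn =>
    obtain ⟨a, ha⟩ := (Submodule.mem_span_image_finset_iff_exists_fun R).mp hn
    classical
    refine ⟨fun i => if h : i ∈ t then m * a ⟨i, h⟩ else 0, fun i => ?_, ?_⟩
    · dsimp only
      split_ifs
      exacts [J.mul_mem_right _ hm, J.zero_mem]
    · rw [← ha, mul_sum, ← sum_coe_sort t]
      exact sum_congr rfl fun i _ => by simp [mul_assoc]
  | add x _ y _ hx hy =>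
    obtain ⟨g, hg, rfl⟩ := hx
    obtain ⟨h, hh, rfl⟩ := hy
    exact ⟨fun i => g i + h i, fun i => J.add_mem (hg i) (hh i), by
      simp [add_mul, sum_add_distrib]⟩

/-! ### Intersections of the ideals `J_t` and of their squares. -/

namespace StarConfig

open Finset

section Regular

variable {R ι : Type*} [CommRing R]

/-- Modulo `K` and any at most `c` of the elements `F i`, `i ∈ S`, each of the others is a
nonzerodivisor. -/
def RegularUpTo (K : Ideal R) (c : ℕ) (S : Finset ι) (F : ι → R) : Prop :=
  ∀ U ⊆ S, #U ≤ c → ∀ i ∈ S, i ∉ U → ∀ a,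
    F i * a ∈ K ⊔ Ideal.span (F '' U) → a ∈ K ⊔ Ideal.span (F '' U)

/-- The ideal generated by the products of the `F i` over the sets `T ⊆ S` with at least
`#S - c + d` elements. -/
def prodIdeal (F : ι → R) (S : Finset ι) (c d : ℕ) : Ideal R :=
  Ideal.span {x | ∃ T ⊆ S, #S + d ≤ #T + c ∧ ∏ i ∈ T, F i = x}

theorem span_image_mono (F : ι → R) {U T : Finset ι} (h : U ⊆ T) :
    Ideal.span (F '' U) ≤ Ideal.span (F '' T) :=
  Ideal.span_mono (Set.image_mono (by exact_mod_cast h))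

theorem prod_mem_prodIdeal (F : ι → R) {S T : Finset ι} {c d : ℕ} (hT : T ⊆ S)
    (h : #S + d ≤ #T + c) : ∏ i ∈ T, F i ∈ prodIdeal F S c d :=
  Ideal.subset_span ⟨T, hT, h, rfl⟩

theorem prodIdeal_le_succ (F : ι → R) (S : Finset ι) (c d : ℕ) :
    prodIdeal F S c d ≤ prodIdeal F S (c + 1) (d + 1) := by
  refine Ideal.span_le.mpr ?_
  rintro _ ⟨T, hT, h, rfl⟩
  exact prod_mem_prodIdeal F hT (by omega)

theorem prodIdeal_anti (F : ι → R) (S : Finset ι) (c d : ℕ) :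
    prodIdeal F S c (d + 1) ≤ prodIdeal F S c d := by
  refine Ideal.span_le.mpr ?_
  rintro _ ⟨T, hT, h, rfl⟩
  exact prod_mem_prodIdeal F hT (by omega)

theorem one_mem_prodIdeal_empty (F : ι → R) (c : ℕ) :
    1 ∈ prodIdeal F ∅ (c + 1) 1 := by
  simpa using prod_mem_prodIdeal F (Subset.refl ∅) (c := c + 1) (d := 1) (by simp)

theorem RegularUpTo.mono {K : Ideal R} {c : ℕ} {S : Finset ι} {F : ι → R} {S' : Finset ι} (h : RegularUpTo K c S F) (hS : S' ⊆ S) :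
    RegularUpTo K c S' F :=
  fun U hU hc i hi => h U (hU.trans hS) hc i (hS hi)

variable [DecidableEq ι]

theorem span_image_insert (F : ι → R) (g : ι) (t : Finset ι) :
    Ideal.span (F '' (insert g t : Finset ι)) = Ideal.span {F g} ⊔ Ideal.span (F '' t) := by
  rw [coe_insert, Set.image_insert_eq, Ideal.span_insert]

/-- `T` misses at most `c - d` elements of `S`, so it meets `t` in at least `d`. -/
theorem prodIdeal_le_pow (F : ι → R) {S t : Finset ι} {c d : ℕ} (ht : t ⊆ S) (hc : #t = c) :
    prodIdeal F S c d ≤ Ideal.span (F '' t) ^ d := by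
  refine Ideal.span_le.mpr ?_
  rintro _ ⟨T, hT, h, rfl⟩
  have h1 : d ≤ #(T ∩ t) := by
    have := card_inter_add_card_union T t
    have := card_le_card (union_subset hT ht)
    omega
  have h2 : ∏ i ∈ T ∩ t, F i ∈ Ideal.span (F '' t) ^ #(T ∩ t) := by
    rw [← prod_const]
    exact Ideal.prod_mem_prod fun i hi =>
      Ideal.subset_span ⟨i, by simpa using (mem_inter.mp hi).2, rfl⟩
  rw [← prod_inter_mul_prod_sdiff T t]
  exact Ideal.mul_mem_right _ _ (Ideal.pow_le_pow_right h1 h2)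

theorem prodIdeal_le_insert (F : ι → R) {g : ι} {S : Finset ι} (hg : g ∉ S) (c d : ℕ) :
    prodIdeal F S c d ≤ prodIdeal F (insert g S) (c + 1) d := by
  refine Ideal.span_le.mpr ?_
  rintro _ ⟨T, hT, h, rfl⟩
  refine prod_mem_prodIdeal F (hT.trans (subset_insert _ _)) ?_
  rw [card_insert_of_notMem hg]
  omega

theorem mul_mem_prodIdeal_insert (F : ι → R) {g : ι} {S : Finset ι} (hg : g ∉ S) {c d : ℕ}
    {y : R} (hy : y ∈ prodIdeal F S c d) : F g * y ∈ prodIdeal F (insert g S) c d := by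
  have : Ideal.span {F g} * prodIdeal F S c d ≤ prodIdeal F (insert g S) c d := by
    rw [prodIdeal, Ideal.span_mul_span', Ideal.span_le]
    rintro _ ⟨_, rfl, _, ⟨T, hT, h, rfl⟩, rfl⟩
    have hgT : g ∉ T := fun h => hg (hT h)
    have := prod_mem_prodIdeal F (insert_subset_insert g hT) (c := c) (d := d) (by
      rw [card_insert_of_notMem hg, card_insert_of_notMem hgT]; omega)
    rwa [prod_insert hgT] at this
  exact this (Ideal.mul_mem_mul (Ideal.mem_span_singleton_self _) hy)

variable {K : Ideal R} {c : ℕ} {S : Finset ι} {F : ι → R}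

theorem RegularUpTo.of_insert {g : ι} (hg : g ∉ S)
    (h : RegularUpTo K (c + 1) (insert g S) F) :
    RegularUpTo (K ⊔ Ideal.span {F g}) c S F := by
  intro U hU hc i hi hiU a ha
  rw [sup_assoc, ← span_image_insert] at ha ⊢
  refine h _ (insert_subset_insert g hU) ((card_insert_le _ _).trans (by omega)) i
    (mem_insert_of_mem hi) ?_ a ha
  rw [mem_insert]
  rintro (rfl | h)
  exacts [hg hi, hiU h]

/-- The relation puts `F i * r i` in `K` plus the ideal of the other `F j`; there are at most `c` of
these, so `F i` cancels. -/
theorem RegularUpTo.coeff_mem (h : RegularUpTo K c S F) {t : Finset ι} (ht : t ⊆ S)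
    (hc : #t ≤ c + 1) {r : ι → R} (hr : ∑ i ∈ t, r i * F i ∈ K) {i : ι} (hi : i ∈ t) :
    r i ∈ K ⊔ Ideal.span (F '' t) := by
  have h1 : r i ∈ K ⊔ Ideal.span (F '' (t.erase i : Finset ι)) := by
    refine h _ ((erase_subset _ _).trans ht) (by rw [card_erase_of_mem hi]; omega) i (ht hi)
      (notMem_erase _ _) _ ?_
    rw [← add_sum_erase _ _ hi] at hr
    rw [show F i * r i = (r i * F i + ∑ j ∈ t.erase i, r j * F j)
      - ∑ j ∈ t.erase i, r j * F j by ring]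
    exact Ideal.sub_mem _ (Ideal.mem_sup_left hr) (Ideal.mem_sup_right
      (Ideal.sum_mem _ fun j hj => Ideal.mul_mem_left _ _ (Ideal.subset_span ⟨j, hj, rfl⟩)))
  exact sup_le_sup_left (span_image_mono F (erase_subset i t)) K h1

/-- Modulo `K`, `coeff_mem` makes `J/J²` free over `R/J` on the `F i`. Hence `u`, injective on
`R/J`, is injective on `J/J²` and so on `R/J²`. -/
theorem RegularUpTo.mem_sq (h : RegularUpTo K c S F) {t : Finset ι} (ht : t ⊆ S)
    (hc : #t ≤ c + 1) {u x : R}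
    (hu : ∀ a, u * a ∈ K ⊔ Ideal.span (F '' t) → a ∈ K ⊔ Ideal.span (F '' t))
    (hx : u * x ∈ K ⊔ Ideal.span (F '' t) ^ 2) : x ∈ K ⊔ Ideal.span (F '' t) ^ 2 := by
  set J := Ideal.span (F '' t) with hJ
  obtain ⟨k, hk, y, hy, hxy⟩ := Submodule.mem_sup.mp
    (hu x (sup_le_sup_left (Ideal.pow_le_self two_ne_zero) K hx))
  obtain ⟨r, -, rfl⟩ := Ideal.exists_sum_of_mem_mul_span_image ⊤ F t (by rwa [Ideal.top_mul])
  obtain ⟨k', hk', z, hz, huz⟩ := Submodule.mem_sup.mp hx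
  rw [pow_two] at hz
  obtain ⟨g, hg, rfl⟩ := Ideal.exists_sum_of_mem_mul_span_image J F t hz
  have key : ∑ i ∈ t, (u * r i - g i) * F i ∈ K := by
    have : ∑ i ∈ t, (u * r i - g i) * F i = k' - u * k := by
      simp only [sub_mul, sum_sub_distrib, mul_assoc, ← mul_sum]
      linear_combination u * hxy - huz
    rw [this]
    exact K.sub_mem hk' (K.mul_mem_left _ hk)
  have hr : ∀ i ∈ t, r i ∈ K ⊔ J := fun i hi => by
    refine hu _ ?_
    have := h.coeff_mem ht hc key hi
    simpa using Ideal.add_mem _ this (Ideal.mem_sup_right (hg i))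
  rw [← hxy]
  refine Ideal.add_mem _ (Ideal.mem_sup_left hk) (Ideal.sum_mem _ fun i hi => ?_)
  have hF : F i ∈ J := Ideal.subset_span ⟨i, hi, rfl⟩
  have : (K ⊔ J) * J ≤ K ⊔ J ^ 2 := by
    rw [Ideal.sup_mul, pow_two]
    exact sup_le_sup_right Ideal.mul_le_left _
  exact this (Ideal.mul_mem_mul (hr i hi) hF)

theorem exists_of_mem_sup_span_singleton {K A : Ideal R} {g x : R}
    (hx : x ∈ K ⊔ Ideal.span {g} ⊔ A) : ∃ k ∈ K, ∃ a ∈ A, ∃ y, k + a + g * y = x := by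
  obtain ⟨z, hz, a, ha, rfl⟩ := Submodule.mem_sup.mp hx
  obtain ⟨k, hk, w, hw, rfl⟩ := Submodule.mem_sup.mp hz
  obtain ⟨y, rfl⟩ := Ideal.mem_span_singleton'.mp hw
  exact ⟨k, hk, a, ha, y, by ring⟩

theorem RegularUpTo.mem_prodIdeal (h : RegularUpTo K c S F) {x : R}
    (hx : ∀ t ⊆ S, #t = c → x ∈ K ⊔ Ideal.span (F '' t)) : x ∈ K ⊔ prodIdeal F S c 1 := by
  induction S using Finset.induction_on generalizing c K x with
  | empty =>
    rcases c with _ | c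
    · have := hx ∅ (Subset.refl _) rfl
      simp only [coe_empty, Set.image_empty, Ideal.span_empty, sup_bot_eq] at this
      exact Ideal.mem_sup_left this
    · refine Ideal.mem_sup_right ?_
      simpa using Ideal.mul_mem_left _ x (one_mem_prodIdeal_empty F c)
  | insert g S hg ih =>
    rcases c with _ | c
    · have := hx ∅ (empty_subset _) rfl
      simp only [coe_empty, Set.image_empty, Ideal.span_empty, sup_bot_eq] at this
      exact Ideal.mem_sup_left this
    -- The sets `insert g t` give the hypothesis modulo `F g`.
    have h1 : x ∈ K ⊔ Ideal.span {F g} ⊔ prodIdeal F S c 1 := by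
      refine ih (h.of_insert hg) fun t ht hc => ?_
      rw [sup_assoc, ← span_image_insert]
      exact hx _ (insert_subset_insert g ht)
        (by rw [card_insert_of_notMem fun h => hg (ht h), hc])
    obtain ⟨k, hk, a, ha, y, rfl⟩ := exists_of_mem_sup_span_singleton h1
    -- For `t` avoiding `g`, both `x` and `k + a` lie in `K ⊔ J_t`, and `F g` cancels.
    have hy : y ∈ K ⊔ prodIdeal F S (c + 1) 1 := by
      refine ih (h.mono (subset_insert g S)) fun t ht hc => ?_
      refine h t (ht.trans (subset_insert g S)) hc.le g (mem_insert_self _ _)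
        (fun h => hg (ht h)) y ?_
      have ha' : a ∈ Ideal.span (F '' t) := by
        simpa using prodIdeal_le_pow F ht hc (prodIdeal_anti F S _ _ (prodIdeal_le_succ F S _ _ ha))
      have := Ideal.sub_mem _ (hx t (ht.trans (subset_insert g S)) hc)
        (Ideal.add_mem _ (Ideal.mem_sup_left hk) (Ideal.mem_sup_right ha'))
      simpa using this
    refine Ideal.add_mem _ (Ideal.add_mem _ (Ideal.mem_sup_left hk)
      (Ideal.mem_sup_right (prodIdeal_le_insert F hg _ _ ha))) ?_
    obtain ⟨k', hk', b, hb, rfl⟩ := Submodule.mem_sup.mp hy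
    rw [mul_add]
    exact Ideal.add_mem _ (Ideal.mem_sup_left (K.mul_mem_left _ hk'))
      (Ideal.mem_sup_right (mul_mem_prodIdeal_insert F hg hb))

theorem sq_sup_le (K J : Ideal R) (g : R) :
    K ⊔ (Ideal.span {g} ⊔ J) ^ 2 ≤ K ⊔ Ideal.span {g} ⊔ J ^ 2 := by
  have : (Ideal.span {g} ⊔ J) ^ 2 ≤ Ideal.span {g} ⊔ J ^ 2 := by
    rw [pow_two, Ideal.sup_mul, Ideal.mul_sup J, pow_two]
    exact sup_le (Ideal.mul_le_left.trans le_sup_left)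
      (sup_le (Ideal.mul_le_right.trans le_sup_left) le_sup_right)
  rw [sup_assoc]
  exact sup_le_sup_left this K

theorem exists_of_mem_sup_sq {K J : Ideal R} {g x : R}
    (hx : x ∈ K ⊔ (Ideal.span {g} ⊔ J) ^ 2) :
    ∃ w ∈ Ideal.span {g} ⊔ J, x - g * w ∈ K ⊔ J ^ 2 := by
  have : K ⊔ (Ideal.span {g} ⊔ J) ^ 2 ≤ Ideal.span {g} * (Ideal.span {g} ⊔ J) ⊔ (K ⊔ J ^ 2) := by
    rw [pow_two, Ideal.sup_mul (Ideal.span {g}), Ideal.mul_sup J, pow_two]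
    refine sup_le (le_sup_left.trans le_sup_right) (sup_le le_sup_left (sup_le ?_ ?_))
    · rw [mul_comm]
      exact (Ideal.mul_mono_right le_sup_right).trans le_sup_left
    · exact le_sup_right.trans le_sup_right
  obtain ⟨y, hy, z, hz, rfl⟩ := Submodule.mem_sup.mp (this hx)
  obtain ⟨w, hw, rfl⟩ := Ideal.mem_span_singleton_mul.mp hy
  exact ⟨w, hw, by simpa using hz⟩

theorem prodIdeal_sup_sq_le (F : ι → R) {S t : Finset ι} {c : ℕ} (ht : t ⊆ S) (hc : #t = c) :
    prodIdeal F S c 2 ⊔ prodIdeal F S c 1 ^ 2 ≤ Ideal.span (F '' t) ^ 2 := by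
  refine sup_le (prodIdeal_le_pow F ht hc) (Ideal.pow_right_mono ?_ 2)
  simpa using prodIdeal_le_pow F ht hc (d := 1)

theorem RegularUpTo.mem_prodIdeal_sup_sq (h : RegularUpTo K c S F) {x : R}
    (hx : ∀ t ⊆ S, #t = c → x ∈ K ⊔ Ideal.span (F '' t) ^ 2) :
    x ∈ K ⊔ (prodIdeal F S c 2 ⊔ prodIdeal F S c 1 ^ 2) := by
  induction S using Finset.induction_on generalizing c K x with
  | empty =>
    rcases c with _ | c
    · have := hx ∅ (Subset.refl _) rfl
      simp only [coe_empty, Set.image_empty, Ideal.span_empty] at this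
      simp only [pow_two, Ideal.bot_mul, sup_bot_eq] at this
      exact Ideal.mem_sup_left this
    · refine Ideal.mem_sup_right (Ideal.mem_sup_right ?_)
      rw [(Ideal.eq_top_iff_one _).mpr (one_mem_prodIdeal_empty F c), pow_two, Ideal.top_mul]
      trivial
  | insert g S hg ih =>
    have hS := subset_insert g S
    rcases c with _ | c
    · have := hx ∅ (empty_subset _) rfl
      simp only [coe_empty, Set.image_empty, Ideal.span_empty] at this
      simp only [pow_two, Ideal.bot_mul, sup_bot_eq] at this
      exact Ideal.mem_sup_left this
    have hcard : ∀ t ⊆ S, #t = c → #(insert g t) = c + 1 := fun t ht hc => by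
      rw [card_insert_of_notMem fun h => hg (ht h), hc]
    have hgF : ∀ t ⊆ S, #t ≤ c + 1 → ∀ a, F g * a ∈ K ⊔ Ideal.span (F '' t) →
        a ∈ K ⊔ Ideal.span (F '' t) := fun t ht hc a ha =>
      h t (ht.trans hS) hc g (mem_insert_self _ _) (fun h => hg (ht h)) a ha
    have hsq : ∀ t ⊆ S, #t ≤ c + 1 → ∀ a, F g * a ∈ K ⊔ Ideal.span (F '' t) ^ 2 →
        a ∈ K ⊔ Ideal.span (F '' t) ^ 2 := fun t ht hc a ha =>
      h.mem_sq (ht.trans hS) (hc.trans (Nat.le_succ _)) (hgF t ht hc) ha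
    have h1 : x ∈ K ⊔ Ideal.span {F g} ⊔ (prodIdeal F S c 2 ⊔ prodIdeal F S c 1 ^ 2) := by
      refine ih (h.of_insert hg) fun t ht hc => sq_sup_le _ _ _ ?_
      rw [← span_image_insert]
      exact hx _ (insert_subset_insert g ht) (hcard t ht hc)
    obtain ⟨k, hk, a, ha, y, rfl⟩ := exists_of_mem_sup_span_singleton h1
    replace ha : a ∈ prodIdeal F (insert g S) (c + 1) 2 ⊔ prodIdeal F (insert g S) (c + 1) 1 ^ 2 :=
      sup_le_sup (prodIdeal_le_insert F hg _ _)
        (Ideal.pow_right_mono (prodIdeal_le_insert F hg _ _) 2) ha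
    have hy : ∀ t ⊆ insert g S, #t = c + 1 → F g * y ∈ K ⊔ Ideal.span (F '' t) ^ 2 := by
      intro t ht hc
      have := Ideal.sub_mem _ (hx t ht hc) (Ideal.add_mem _ (Ideal.mem_sup_left hk)
        (Ideal.mem_sup_right (prodIdeal_sup_sq_le F ht hc ha)))
      simpa using this
    -- The sets containing `g` are used again: `F g * (y - w) ∈ K ⊔ J_t ^ 2` allows `F g` to be
    -- cancelled, which controls `y` to first order modulo `F g`.
    have hy1 : y ∈ K ⊔ Ideal.span {F g} ⊔ prodIdeal F S c 1 := by
      refine (h.of_insert hg).mem_prodIdeal fun t ht hc => ?_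
      have := hy _ (insert_subset_insert g ht) (hcard t ht hc)
      rw [span_image_insert] at this
      obtain ⟨w, hw, hyw⟩ := exists_of_mem_sup_sq this
      rw [← mul_sub] at hyw
      have h2 := hsq t ht (by omega) _ hyw
      rw [← sub_add_cancel y w, sup_assoc]
      exact Ideal.add_mem _ (sup_le_sup_left ((Ideal.pow_le_self two_ne_zero).trans le_sup_right) K
        h2) (Ideal.mem_sup_right hw)
    obtain ⟨k', hk', b, hb, z, rfl⟩ := exists_of_mem_sup_span_singleton hy1
    -- For `t` avoiding `g`, `F g` is cancelled twice. The term `b` is harmless: a product missing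
    -- at most `c - 1` indices of `S` meets `t`, of size `c + 1`, at least twice.
    have hz : z ∈ K ⊔ (prodIdeal F S (c + 1) 2 ⊔ prodIdeal F S (c + 1) 1 ^ 2) := by
      refine ih (h.mono hS) fun t ht hc => hsq t ht hc.le _ ?_
      have h3 := hsq t ht hc.le _ (hy t (ht.trans hS) hc)
      have := Ideal.sub_mem _ h3 (Ideal.add_mem _ (Ideal.mem_sup_left hk')
        (Ideal.mem_sup_right (prodIdeal_le_pow F ht hc (prodIdeal_le_succ F S _ _ hb))))
      simpa using this
    obtain ⟨k'', hk'', w, hw, rfl⟩ := Submodule.mem_sup.mp hz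
    obtain ⟨p, hp, q, hq, rfl⟩ := Submodule.mem_sup.mp hw
    have hp' : F g * p ∈ prodIdeal F (insert g S) (c + 1) 2 := mul_mem_prodIdeal_insert F hg hp
    have hb' : F g * b ∈ prodIdeal F (insert g S) (c + 1) 2 :=
      mul_mem_prodIdeal_insert F hg (prodIdeal_le_succ F S _ _ hb)
    have hq' : F g ^ 2 * q ∈ prodIdeal F (insert g S) (c + 1) 1 ^ 2 := by
      have : Ideal.span {F g} * prodIdeal F S (c + 1) 1 ≤ prodIdeal F (insert g S) (c + 1) 1 := by
        rw [Ideal.span_singleton_mul_le_iff]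
        exact fun z hz => mul_mem_prodIdeal_insert F hg hz
      refine Ideal.pow_right_mono this 2 ?_
      rw [mul_pow]
      exact Ideal.mul_mem_mul (Ideal.pow_mem_pow (Ideal.mem_span_singleton_self _) 2) hq
    rw [show k + a + F g * (k' + b + F g * (k'' + (p + q))) =
      (k + F g * k' + F g ^ 2 * k'') + (a + (F g * b + F g * (F g * p) + F g ^ 2 * q)) by ring]
    refine Ideal.add_mem _ (Ideal.mem_sup_left ?_) (Ideal.mem_sup_right (Ideal.add_mem _ ha ?_))
    · exact K.add_mem (K.add_mem hk (K.mul_mem_left _ hk')) (K.mul_mem_left _ hk'')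
    · exact Ideal.add_mem _ (Ideal.mem_sup_left (Ideal.add_mem _ hb' (Ideal.mul_mem_left _ _ hp')))
        (Ideal.mem_sup_right hq')

end Regular

end StarConfig

/-! ### Associated primes and the symbolic square. -/

theorem Ideal.isAssociatedPrime_quotient_iff {R : Type*} [CommRing R] [IsNoetherianRing R]
    {J P : Ideal R} :
    IsAssociatedPrime P (R ⧸ J) ↔ P.IsPrime ∧ ∃ y, ∀ r, r ∈ P ↔ r * y ∈ J := by
  rw [isAssociatedPrime_iff]
  refine and_congr_right fun _ => ?_
  rw [(Ideal.Quotient.mk_surjective (I := J)).exists]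
  refine exists_congr fun y => ?_
  rw [SetLike.ext_iff]
  refine forall_congr' fun r => iff_congr Iff.rfl ?_
  rw [Submodule.mem_colon_singleton, Submodule.mem_bot, ← Ideal.Quotient.eq_zero_iff_mem]
  rfl

namespace StarConfig

open Finset

theorem mem_symbolicPower_iff {R : Type*} [CommRing R] {I : Ideal R} {m : ℕ} {x : R} :
    x ∈ symbolicPower I m ↔ ∀ P ∈ associatedPrimes R (R ⧸ I), ∃ u ∉ P, u * x ∈ I ^ m := by
  simp only [symbolicPower, Ideal.mem_iInf, Subtype.forall, Ideal.mem_comap]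
  refine forall₂_congr fun P hP => ?_
  have : P.IsPrime := hP.isPrime
  rw [IsLocalization.algebraMap_mem_map_algebraMap_iff P.primeCompl]
  rfl

section Regular

variable {R ι : Type*} [CommRing R] [DecidableEq ι] {c : ℕ} {S : Finset ι} {F : ι → R}

theorem RegularUpTo.mem_of_prod_mul_mem {K : Ideal R} (h : RegularUpTo K c S F) {U V : Finset ι}
    (hU : U ⊆ S) (hc : #U ≤ c) (hV : V ⊆ S) (hd : Disjoint U V) {a : R}
    (ha : (∏ i ∈ V, F i) * a ∈ K ⊔ Ideal.span (F '' U)) : a ∈ K ⊔ Ideal.span (F '' U) := by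
  induction V using Finset.induction_on with
  | empty => simpa using ha
  | insert g V hg ih =>
    rw [prod_insert hg, mul_assoc] at ha
    refine ih ((subset_insert _ _).trans hV) (hd.mono_right (subset_insert _ _)) ?_
    exact h U hU hc g (hV (mem_insert_self _ _))
      (disjoint_right.mp hd (mem_insert_self _ _)) _ ha

end Regular

section StarIdeal

variable {R : Type*} [CommRing R] {s c : ℕ} {F : Fin s → R}

theorem mem_starIdeal_iff {x : R} :
    x ∈ starIdeal c F ↔ ∀ t : Finset (Fin s), #t = c → x ∈ Ideal.span (F '' t) := by
  simp [starIdeal]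

theorem starIdeal_le {t : Finset (Fin s)} (ht : #t = c) :
    starIdeal c F ≤ Ideal.span (F '' t) :=
  fun _ hx => mem_starIdeal_iff.mp hx t ht

theorem prod_compl_mul_mem_starIdeal {t : Finset (Fin s)} (ht : #t = c) {x : R}
    (hx : x ∈ Ideal.span (F '' t)) : (∏ i ∈ tᶜ, F i) * x ∈ starIdeal c F := by
  refine mem_starIdeal_iff.mpr fun t' ht' => ?_
  by_cases h : t' ⊆ t
  · rw [eq_of_subset_of_card_le h (by omega)]
    exact Ideal.mul_mem_left _ _ hx
  · obtain ⟨j, hj, hjt⟩ := not_subset.mp h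
    refine Ideal.mul_mem_right _ _ (Ideal.mem_of_dvd _ (dvd_prod_of_mem F (mem_compl.mpr hjt)) ?_)
    exact Ideal.subset_span ⟨j, hj, rfl⟩

theorem starIdeal_eq_prodIdeal (h : RegularUpTo ⊥ c univ F) :
    starIdeal c F = prodIdeal F univ c 1 := by
  refine le_antisymm (fun x hx => ?_) fun x hx => mem_starIdeal_iff.mpr fun t ht => ?_
  · simpa using h.mem_prodIdeal (x := x) fun t _ ht => Ideal.mem_sup_right (starIdeal_le ht hx)
  · simpa using prodIdeal_le_pow F (subset_univ t) ht hx

/-- If `P = I : y = ⋂ (J_t : y)` is prime, it contains, hence equals, some `J_t : y`. Conversely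
`J_t : y = I : Gy`, where `G` is the product of the `F i` outside `t`, a nonzerodivisor modulo
`J_t`. -/
theorem isAssociatedPrime_starIdeal_iff [IsNoetherianRing R] (h : RegularUpTo ⊥ c univ F)
    {P : Ideal R} :
    IsAssociatedPrime P (R ⧸ starIdeal c F) ↔
      ∃ t : Finset (Fin s), #t = c ∧ IsAssociatedPrime P (R ⧸ Ideal.span (F '' t)) := by
  simp only [Ideal.isAssociatedPrime_quotient_iff]
  constructor
  · rintro ⟨hP, y, hy⟩
    let J : Finset (Fin s) → Ideal R := fun t => (Ideal.span (F '' t)).colon {y}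
    have hJ : ∀ t r, r ∈ J t ↔ r * y ∈ Ideal.span (F '' t) := fun t r =>
      Submodule.mem_colon_singleton
    have hle : (powersetCard c (univ : Finset (Fin s))).inf J ≤ P := by
      intro r hr
      rw [hy, mem_starIdeal_iff]
      intro t ht
      rw [← hJ]
      exact (Finset.inf_le (f := J) (mem_powersetCard_univ.mpr ht)) hr
    obtain ⟨t, ht, htP⟩ := hP.inf_le'.mp hle
    rw [mem_powersetCard_univ] at ht
    refine ⟨t, ht, hP, y, fun r => ⟨fun hr => ?_, fun hr => htP ((hJ t r).mpr hr)⟩⟩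
    exact starIdeal_le ht ((hy r).mp hr)
  · rintro ⟨t, ht, hP, y, hy⟩
    refine ⟨hP, (∏ i ∈ tᶜ, F i) * y, fun r => ?_⟩
    rw [hy, mul_left_comm]
    refine ⟨prod_compl_mul_mem_starIdeal ht, fun hr => ?_⟩
    simpa using h.mem_of_prod_mul_mem (subset_univ t) ht.le (subset_univ _)
      disjoint_compl_right (Ideal.mem_sup_right (starIdeal_le ht hr))

theorem symbolicPower_starIdeal_two [IsNoetherianRing R] (h : RegularUpTo ⊥ c univ F) :
    symbolicPower (starIdeal c F) 2 = prodIdeal F univ c 2 ⊔ starIdeal c F ^ 2 := by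
  refine le_antisymm (fun x hx => ?_) (sup_le (fun x hx => ?_) (pow_le_symbolicPower _ _))
  · rw [starIdeal_eq_prodIdeal h, ← bot_sup_eq (_ ⊔ _)]
    refine h.mem_prodIdeal_sup_sq fun t ht hc => ?_
    rw [mem_symbolicPower_iff] at hx
    set J := Ideal.span (F '' t)
    -- Prime avoidance gives one `u` with `u * x ∈ J ^ 2` outside every associated prime of `R/J`,
    -- that is, a nonzerodivisor modulo `J`.
    have hA : ¬ (((J ^ 2).colon {x} : Ideal R) : Set R) ⊆
        ⋃ P ∈ associatedPrimes R (R ⧸ J), (P : Set R) := by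
      rw [Ideal.subset_union_prime_finite (associatedPrimes.finite R (R ⧸ J)) ⊥ ⊥
        fun P hP _ _ => hP.isPrime]
      rintro ⟨P, hP, hAP⟩
      obtain ⟨u, hu, hux⟩ := hx P ((isAssociatedPrime_starIdeal_iff h).mpr ⟨t, hc, hP⟩)
      exact hu (hAP (Submodule.mem_colon_singleton.mpr
        (Ideal.pow_right_mono (starIdeal_le hc) 2 hux)))
    rw [biUnion_associatedPrimes_eq_compl_regular, Set.not_subset] at hA
    obtain ⟨u, hu, hreg⟩ := hA
    rw [Set.notMem_compl_iff, Set.mem_ofPred_eq, isSMulRegular_quotient_iff_mem_of_smul_mem] at hreg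
    refine h.mem_sq ht (by omega) (u := u) (fun a ha => ?_)
      (Ideal.mem_sup_right (Submodule.mem_colon_singleton.mp hu))
    rw [bot_sup_eq] at ha ⊢
    exact hreg a ha
  · refine mem_symbolicPower_iff.mpr fun P hP => ?_
    obtain ⟨t, ht, hPt⟩ := (isAssociatedPrime_starIdeal_iff h).mp hP
    obtain ⟨hprime, y, hy⟩ := Ideal.isAssociatedPrime_quotient_iff.mp hPt
    have hG : ∏ i ∈ tᶜ, F i ∉ P := fun hG => hprime.ne_top <| (Ideal.eq_top_iff_one _).mpr <| by
      rw [hy, one_mul]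
      simpa using h.mem_of_prod_mul_mem (subset_univ t) ht.le (subset_univ _)
        disjoint_compl_right (Ideal.mem_sup_right ((hy _).mp hG))
    refine ⟨(∏ i ∈ tᶜ, F i) ^ 2, fun h => hG (hprime.mem_of_pow_mem _ h), ?_⟩
    have hle : Ideal.span {∏ i ∈ tᶜ, F i} * Ideal.span (F '' t) ≤ starIdeal c F :=
      Ideal.span_singleton_mul_le_iff.mpr fun z hz => prod_compl_mul_mem_starIdeal ht hz
    refine Ideal.pow_right_mono hle 2 ?_
    rw [mul_pow]
    exact Ideal.mul_mem_mul (Ideal.pow_mem_pow (Ideal.mem_span_singleton_self _) 2)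
      (prodIdeal_le_pow F (subset_univ t) ht hx)

end StarIdeal

end StarConfig

/-! ### From regular sequences to `RegularUpTo`. -/

namespace StarConfig

open Finset

theorem exists_embedding_prefix {s m : ℕ} (hm : m ≤ s) (L : List (Fin s)) (hL : L.Nodup) :
    ∃ e : Fin m ↪ Fin s, ∀ j : Fin m, ∀ h : j < L.length, e j = L[j] := by
  let M := L ++ (univ \ L.toFinset).toList
  have hM : M.Nodup := by
    refine List.Nodup.append hL (nodup_toList _) fun a ha hb => ?_
    simp [ha] at hb
  have hlen : M.length = s := by
    rw [← List.toFinset_card_of_nodup hM]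
    have : M.toFinset = univ := by
      ext a
      by_cases ha : a ∈ L <;> simp [M, ha]
    rw [this, card_univ, Fintype.card_fin]
  refine ⟨⟨fun j => M[j]'(by omega), fun i j hij => ?_⟩, fun j h => ?_⟩
  · exact Fin.ext ((hM.getElem_inj_iff).mp hij)
  · exact List.getElem_append_left h

theorem IsStarFamily.regularUpTo {k : Type*} [Field k] {n c s : ℕ}
    {F : Fin s → MvPolynomial (Fin (n + 1)) k} (hF : IsStarFamily c F) :
    RegularUpTo ⊥ c univ F := by
  intro U _ hU i _ hi a ha
  rw [bot_sup_eq] at ha ⊢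
  have hs : c + 1 ≤ s := by have := hF.le_dim; have := hF.lt_card; omega
  -- `U` may have fewer than `c` elements, so `U` followed by `i` is completed to `c + 1` distinct
  -- indices.
  obtain ⟨e, he⟩ := exists_embedding_prefix hs (U.toList ++ [i])
    (List.Nodup.append (nodup_toList _) (List.nodup_singleton _) (by simpa using hi))
  have hr := (hF.regular e).regular_mod_prev #U (by simp; omega)
  have htake : (List.ofFn fun j => F (e j)).take #U = U.toList.map F := by
    refine List.ext_getElem (by simp; omega) fun j h1 h2 => ?_
    have hj : j < #U := by simpa using h2
    have hj' : j < U.toList.length := by simpa using h2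
    have := he ⟨j, by omega⟩ (by simp; omega)
    simp only [List.getElem_take, List.getElem_ofFn, List.getElem_map, this]
    congr 1
    exact List.getElem_append_left hj'
  have hget : (List.ofFn fun j => F (e j))[#U]'(by simp; omega) = F i := by
    have := he ⟨#U, by omega⟩ (by simp)
    simp only [List.getElem_ofFn, this]
    congr 1
    simp [List.getElem_append_right]
  rw [htake, hget, isSMulRegular_quotient_iff_mem_of_smul_mem] at hr
  have hspan : (Ideal.ofList (U.toList.map F) • ⊤ : Ideal (MvPolynomial (Fin (n + 1)) k)) =
      Ideal.span (F '' U) := by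
    rw [smul_eq_mul, Ideal.mul_top, Ideal.ofList]
    congr 1
    ext x
    simp
  rw [hspan] at hr
  exact hr a ha

end StarConfig

/-! ### Components of lowest degree and numbers of generators. -/

namespace MvPolynomial

variable {σ k : Type*} [Field k]

theorem IsHomogeneous.mem_idealOfVars_pow {p : MvPolynomial σ k} {d : ℕ} (hp : p.IsHomogeneous d) :
    p ∈ idealOfVars σ k ^ d :=
  (mem_pow_idealOfVars_iff' d p).mpr fun _ hx => hp.coeff_eq_zero hx.ne

theorem homogeneousComponent_eq_zero_of_mem_pow {p : MvPolynomial σ k} {d : ℕ}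
    (hp : p ∈ idealOfVars σ k ^ (d + 1)) : homogeneousComponent d p = 0 := by
  ext x
  rw [coeff_homogeneousComponent, coeff_zero]
  split_ifs with h
  · exact (mem_pow_idealOfVars_iff' _ p).mp hp x (by omega)
  · rfl

theorem homogeneousComponent_mul_of_mem_pow (r : MvPolynomial σ k) {p : MvPolynomial σ k} {d : ℕ}
    (hp : p ∈ idealOfVars σ k ^ d) :
    homogeneousComponent d (r * p) = coeff 0 r • homogeneousComponent d p := by
  have h0 : r - C (coeff 0 r) ∈ idealOfVars σ k ^ 1 := by
    refine (mem_pow_idealOfVars_iff' 1 _).mpr fun x hx => ?_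
    obtain rfl : x = 0 := (Finsupp.degree_eq_zero_iff x).mp (Nat.lt_one_iff.mp hx)
    simp
  have h1 : (r - C (coeff 0 r)) * p ∈ idealOfVars σ k ^ (d + 1) := by
    rw [add_comm, pow_add]
    exact Ideal.mul_mem_mul h0 hp
  have h2 := homogeneousComponent_eq_zero_of_mem_pow h1
  rwa [sub_mul, map_sub, sub_eq_zero, ← smul_eq_C_mul, map_smul] at h2

/-- Linearly independent forms of the least degree occurring in an ideal `N` are part of a minimal
system of generators of `N` modulo any ideal `Q` that starts in a higher degree. -/
theorem card_le_spanFinrank_map_mkQ {d : ℕ} {Q N : Ideal (MvPolynomial σ k)}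
    (hQ : Q ≤ idealOfVars σ k ^ (d + 1)) (hN : N ≤ idealOfVars σ k ^ d)
    (hfg : (Submodule.map (Submodule.mkQ Q) N).FG) {ι : Type*} [Fintype ι]
    {f : ι → MvPolynomial σ k} (hf : ∀ i, f i ∈ N) (hd : ∀ i, (f i).IsHomogeneous d)
    (hli : LinearIndependent k f) :
    Fintype.card ι ≤ (Submodule.map (Submodule.mkQ Q) N).spanFinrank := by
  classical
  obtain ⟨W, hW, hspan⟩ := hfg.exists_span_finset_card_eq_spanFinrank
  have hlift : ∀ w ∈ W, ∃ x ∈ N, Submodule.mkQ Q x = w := fun w hw =>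
    Submodule.mem_map.mp (hspan ▸ Submodule.subset_span hw)
  choose! l hlN hl using hlift
  let V := Submodule.span k (W.image fun w => homogeneousComponent d (l w) : Set (MvPolynomial σ k))
  -- On `N`, scalars act on the degree `d` component through their constant term, so the components
  -- of lifted generators span over `k`.
  have key : ∀ z ∈ Submodule.span (MvPolynomial σ k) (W : Set (MvPolynomial σ k ⧸ Q)),
      ∃ x ∈ N, Submodule.mkQ Q x = z ∧ homogeneousComponent d x ∈ V := by
    intro z hz
    induction hz using Submodule.span_induction with
    | mem w hw =>
      exact ⟨l w, hlN w hw, hl w hw, Submodule.subset_span (Finset.mem_image_of_mem _ hw)⟩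
    | zero => exact ⟨0, N.zero_mem, map_zero _, by simp⟩
    | add _ _ _ _ hx hy =>
      obtain ⟨x, hx, rfl, hxV⟩ := hx
      obtain ⟨y, hy, rfl, hyV⟩ := hy
      exact ⟨x + y, N.add_mem hx hy, map_add _ _ _, by rw [map_add]; exact V.add_mem hxV hyV⟩
    | smul r _ _ hx =>
      obtain ⟨x, hx, rfl, hxV⟩ := hx
      refine ⟨r * x, N.mul_mem_left r hx, (Submodule.mkQ Q).map_smul r x, ?_⟩
      rw [homogeneousComponent_mul_of_mem_pow r (hN hx)]
      exact V.smul_mem _ hxV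
  have hfV : ∀ i, f i ∈ V := by
    intro i
    obtain ⟨x, -, hxf, hxV⟩ := key (Submodule.mkQ Q (f i))
      (hspan ▸ Submodule.mem_map_of_mem (hf i))
    have h := homogeneousComponent_eq_zero_of_mem_pow (hQ ((Submodule.Quotient.eq Q).mp hxf))
    rw [map_sub, sub_eq_zero, homogeneousComponent_eq_self (hd i)] at h
    rwa [← h]
  rw [← hW, ← finrank_span_eq_card hli]
  have hle : Submodule.span k (Set.range f) ≤ V :=
    Submodule.span_le.mpr (Set.range_subset_iff.mpr hfV)
  have : FiniteDimensional k V := FiniteDimensional.span_finset k _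
  exact (Submodule.finrank_mono hle).trans
    ((finrank_span_finset_le_card _).trans Finset.card_image_le)

end MvPolynomial

/-! ### Counting the generators of `I^(2)/I^2`. -/

namespace StarConfig

open Finset MvPolynomial

theorem prodIdeal_eq_span_image {R : Type*} [CommRing R] {s c : ℕ} (F : Fin s → R)
    (hs : c ≤ s) : prodIdeal F univ c 2 =
      Ideal.span ((fun T => ∏ i ∈ T, F i) ''
        ((powersetCard (s + 2 - c) univ : Finset (Finset (Fin s))) : Set (Finset (Fin s)))) := by
  refine le_antisymm (Ideal.span_le.mpr ?_) (Ideal.span_le.mpr ?_)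
  · rintro _ ⟨T, -, h, rfl⟩
    rw [card_univ, Fintype.card_fin] at h
    obtain ⟨T', hT', hcard⟩ := exists_subset_card_eq (show s + 2 - c ≤ #T by omega)
    refine Ideal.mem_of_dvd _ (prod_dvd_prod_of_subset T' T F hT') ?_
    exact Ideal.subset_span ⟨T', mem_powersetCard_univ.mpr hcard, rfl⟩
  · rintro _ ⟨T, hT, rfl⟩
    refine prod_mem_prodIdeal F (subset_univ T) ?_
    rw [mem_powersetCard_univ.mp hT, card_univ, Fintype.card_fin]
    omega

theorem symbolicQuotient_starIdeal_two {R : Type*} [CommRing R] [IsNoetherianRing R] {s c : ℕ}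
    {F : Fin s → R} (h : RegularUpTo ⊥ c univ F) :
    symbolicQuotient (starIdeal c F) 2 =
      Submodule.map (Submodule.mkQ (starIdeal c F ^ 2)) (prodIdeal F univ c 2) := by
  rw [symbolicQuotient, symbolicPower_starIdeal_two h, Submodule.map_sup, Submodule.mkQ_map_self,
    sup_bot_eq]

theorem sdefect_starIdeal_two_le {R : Type*} [CommRing R] [IsNoetherianRing R] {s c : ℕ}
    {F : Fin s → R} (h : RegularUpTo ⊥ c univ F) (hc : 1 ≤ c) (hs : c ≤ s) :
    sdefect (starIdeal c F) 2 ≤ binom s ((c : ℤ) - 2) := by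
  rw [sdefect, symbolicQuotient_starIdeal_two h]
  obtain rfl | hc2 : c = 1 ∨ 2 ≤ c := by omega
  -- A generator would need `s + 1` distinct indices.
  · have : prodIdeal F univ 1 2 = ⊥ := by
      refine le_bot_iff.mp (Ideal.span_le.mpr ?_)
      rintro _ ⟨T, hT, h, rfl⟩
      have := card_le_card hT
      omega
    simp [this]
  · rw [prodIdeal_eq_span_image F hs, Ideal.span, Submodule.map_span]
    refine (Submodule.spanFinrank_span_le_ncard_of_finite
      ((finite_toSet _).image _ |>.image _)).trans ?_
    refine (Set.ncard_image_le ((finite_toSet _).image _)).trans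
      ((Set.ncard_image_le (finite_toSet _)).trans ?_)
    rw [Set.ncard_coe_finset, card_powersetCard, card_univ, Fintype.card_fin, binom,
      if_neg (by omega), show ((c : ℤ) - 2).toNat = c - 2 by omega,
      ← Nat.choose_symm (show c - 2 ≤ s by omega), show s + 2 - c = s - (c - 2) by omega]

section Linear

variable {k σ : Type*} [Field k] {s c : ℕ} {F : Fin s → MvPolynomial σ k}

theorem prodIdeal_le_idealOfVars_pow (hF : ∀ i, (F i).IsHomogeneous 1) (c d : ℕ) :
    prodIdeal F univ c d ≤ idealOfVars σ k ^ (s + d - c) := by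
  refine Ideal.span_le.mpr ?_
  rintro _ ⟨T, -, h, rfl⟩
  rw [card_univ, Fintype.card_fin] at h
  have := (IsHomogeneous.prod T F (fun _ => 1) fun i _ => hF i).mem_idealOfVars_pow
  rw [sum_const, smul_eq_mul, mul_one] at this
  exact Ideal.pow_le_pow_right (by omega) this

/-- Modulo the at most `c` forms outside `T`, every other product of `m` forms vanishes and the
product over `T` cancels. Its coefficient is then a constant in an ideal generated by linear forms,
so zero. -/
theorem linearIndependent_prod (h : RegularUpTo ⊥ c univ F) (hF : ∀ i, (F i).IsHomogeneous 1)
    {m : ℕ} (hm : s ≤ m + c) :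
    LinearIndependent k fun T : (powersetCard m univ : Finset (Finset (Fin s))) =>
      ∏ i ∈ T.1, F i := by
  rw [Fintype.linearIndependent_iff]
  intro g hg T
  have hT := mem_powersetCard_univ.mp T.2
  have hmem : (∏ i ∈ T.1, F i) * C (g T) ∈ Ideal.span (F '' (T.1ᶜ : Finset (Fin s))) := by
    rw [← add_sum_erase _ _ (mem_univ T), add_eq_zero_iff_eq_neg, smul_eq_C_mul, mul_comm] at hg
    rw [hg]
    refine neg_mem (Ideal.sum_mem _ fun T' hT' => ?_)
    have hsub : ¬ T'.1 ⊆ T.1 := fun hsub => (mem_erase.mp hT').1 <| Subtype.ext <|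
      eq_of_subset_of_card_le hsub (by rw [hT, mem_powersetCard_univ.mp T'.2])
    obtain ⟨j, hj, hjT⟩ := not_subset.mp hsub
    rw [smul_eq_C_mul]
    refine Ideal.mul_mem_left _ _ (Ideal.mem_of_dvd _ (dvd_prod_of_mem F hj) ?_)
    exact Ideal.subset_span ⟨j, mem_compl.mpr hjT, rfl⟩
  have hC : C (g T) ∈ Ideal.span (F '' (T.1ᶜ : Finset (Fin s))) := by
    simpa using h.mem_of_prod_mul_mem (subset_univ _)
      (by rw [card_compl, Fintype.card_fin]; omega)
      (subset_univ T.1) disjoint_compl_left (Ideal.mem_sup_right hmem)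
  have hle : Ideal.span (F '' (T.1ᶜ : Finset (Fin s))) ≤ idealOfVars σ k ^ 1 := by
    refine Ideal.span_le.mpr ?_
    rintro _ ⟨i, -, rfl⟩
    exact (hF i).mem_idealOfVars_pow
  simpa using (C_mem_pow_idealOfVars_iff 1 (g T)).mp (hle hC)

theorem le_sdefect_starIdeal_two [Finite σ] (h : RegularUpTo ⊥ c univ F)
    (hF : ∀ i, (F i).IsHomogeneous 1) (hs : c < s) :
    binom s ((c : ℤ) - 2) ≤ sdefect (starIdeal c F) 2 := by
  rw [binom]
  split_ifs with hc
  · exact Nat.zero_le _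
  have hfg := symbolicQuotient_fg (starIdeal c F) 2
  rw [sdefect]
  rw [symbolicQuotient_starIdeal_two h] at hfg ⊢
  -- `2 * (s + 1 - c) ≥ s + 3 - c` because `c < s`.
  have hQ : starIdeal c F ^ 2 ≤ idealOfVars σ k ^ (s + 2 - c + 1) := by
    rw [starIdeal_eq_prodIdeal h]
    refine (Ideal.pow_right_mono (prodIdeal_le_idealOfVars_pow hF c 1) 2).trans ?_
    rw [← pow_mul]
    exact Ideal.pow_le_pow_right (by omega)
  have := card_le_spanFinrank_map_mkQ hQ (prodIdeal_le_idealOfVars_pow hF c 2) hfg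
    (f := fun T : (powersetCard (s + 2 - c) univ : Finset (Finset (Fin s))) => ∏ i ∈ T.1, F i)
    (fun T => by
      refine prod_mem_prodIdeal F (subset_univ _) ?_
      rw [mem_powersetCard_univ.mp T.2, card_univ, Fintype.card_fin]
      omega)
    (fun T => by
      have := IsHomogeneous.prod T.1 F (fun _ => 1) fun i _ => hF i
      rwa [sum_const, smul_eq_mul, mul_one, mem_powersetCard_univ.mp T.2] at this)
    (linearIndependent_prod h hF (by omega))
  rwa [Fintype.card_coe, card_powersetCard, card_univ, Fintype.card_fin,
    show s + 2 - c = s - (c - 2) by omega, Nat.choose_symm (show c - 2 ≤ s by omega),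
    show c - 2 = ((c : ℤ) - 2).toNat by omega] at this

end Linear

end StarConfig

theorem mainTheorem6 {k : Type*} [Field k] (n c s : ℕ)
    (F : Fin s → MvPolynomial (Fin (n + 1)) k) (hF : StarConfig.IsStarFamily c F) :
    StarConfig.sdefect (StarConfig.starIdeal c F) 2 ≤ StarConfig.binom s ((c : ℤ) - 2) ∧
      ((∀ i, (F i).IsHomogeneous 1) →
        StarConfig.sdefect (StarConfig.starIdeal c F) 2 = StarConfig.binom s ((c : ℤ) - 2)) := by
  have hs : c < s := by have := hF.le_dim; have := hF.lt_card; omega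
  have hle := StarConfig.sdefect_starIdeal_two_le hF.regularUpTo hF.one_le hs.le
  exact ⟨hle, fun hlin =>
    le_antisymm hle (StarConfig.le_sdefect_starIdeal_two hF.regularUpTo hlin hs)⟩
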